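/- Fix $\lambda>0$. Consider the pure birth process: a random binary tree that consists at time $0$ of a single root, which is its first leaf, and in which each leaf creates two new leaves (its children, after which it is no longer a leaf) after an exponentially distributed time with mean $1/\lambda$, measured from its creation, all these times being independent. The depth of a leaf is the number of edges between it and the root. Let $Z(t)$ be the number of leaves at time $t\ge 0$ and $G(t)$ the sum of their depths, so that $Z(0)=1$ and $G(0)=0$ almost surely. Then for every $t\ge0$ the set of leaves at time $t$ is almost surely finite and non-empty, $Z(t)$ is a random variable and $G(t)/Z(t)$ is square integrable, and $$\lim_{t\to\infty}\mathbb{E}\Big[\operatorname{Var}\Big(\frac{G(t)}{Z(t)}\,\Big|\,Z(t)\Big)\Big]=7-\frac23\pi^2 .$$ -/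

import Mathlib

open MeasureTheory ProbabilityTheory Filter Topology

/-!  The pure birth (Yule) tree. A node of the growing binary tree is the finite word that
describes the path from the root to it, so the root is the empty word, the two children of `u`
are `u ++ [false]` and `u ++ [true]`, and the depth of `u` is its length. The number `τ u` is the
time between the creation of the node `u` and the creation of its two children. -/

namespace PureBirth

/-- The time at which the node `u` is created: the sum of the waiting times of its proper
ancestors, which are the prefixes `u.take i` with `i < u.length`. -/
noncomputable def birthTime (τ : List Bool → ℝ) (u : List Bool) : ℝ :=
  ∑ i ∈ Finset.range u.length, τ (u.take i)

/-- The leaves at time `t`: the nodes already created whose children are not yet created. -/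
def leaves (τ : List Bool → ℝ) (t : ℝ) : Set (List Bool) :=
  {u | birthTime τ u ≤ t ∧ t < birthTime τ u + τ u}

/-- The number `Z(t)` of leaves at time `t`. -/
noncomputable def Z (τ : List Bool → ℝ) (t : ℝ) : ℕ :=
  (leaves τ t).ncard

/-- The sum `G(t)` of the depths of the leaves at time `t`. -/
noncomputable def G (τ : List Bool → ℝ) (t : ℝ) : ℕ :=
  ∑ᶠ u ∈ leaves τ t, u.length

/-- The average depth `G(t) / Z(t)` of the leaves at time `t`. -/
noncomputable def avgDepth (τ : List Bool → ℝ) (t : ℝ) : ℝ :=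
  (G τ t : ℝ) / (Z τ t : ℝ)

end PureBirth

/-! The proof computes the joint law of `Z(t)` and `G(t)`. Given `Z(t) = m + 1`, the shape of the
tree is that of a random binary search tree with `m` inner nodes, whatever `t` is, so `G(t)` is
distributed like its external path length. Precisely, the probability of
`Z(t) = m + 1`, `G(t) = k` is `exp (-λt) (1 - exp (-λt)) ^ m` times the coefficient of `X ^ k` in a
polynomial `depthPoly m` that satisfies the quadratic recursion of binary search trees
(`treeLaw_treeEvent`). By decomposition at the root, where the subtrees are independent copies of
the tree (`map_node_treeLaw`), induction on `m` shows that this is a lower bound for the probability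
(`le_treeLaw_treeEvent`); the lower bounds for these disjoint events add up to `1`, so they are
equalities, and `Z(t)` is almost surely finite and positive.

Differentiating the recursion at `X = 1` and summing convolutions of harmonic numbers gives the
mean and the variance of the external path length with `n` leaves,
`2 n (H_n - 1)` and `7 n² - n - 4 n² H_n⁽²⁾ - 2 n H_n`
(`depthPoly_sum_mul`, `depthPoly_sum_mul_sq`). The variance divided by `n²` tends to
`7 - 4 (π² / 6)`. The conditional expectation given `Z(t)` is a function of `Z(t)`, so the expected
conditional variance of `G(t) / Z(t)` is the average of these quotients over the geometric law of
`Z(t)` (`integral_condVar_ratio`). The parameter `1 - exp (-λt)` of the law tends to `1` as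
`t → ∞`, and Abel's theorem shows that the averages have the same limit as the quotients
(`tendsto_tsum_leafProb_mul`). -/

namespace PureBirth

/-! ### Convolutions of harmonic numbers -/

section Moments

open Finset Polynomial

/-- The generalized harmonic number `∑_{k = 1}^n 1 / k ^ r`. -/
noncomputable def genHarmonic (r n : ℕ) : ℝ :=
  ∑ k ∈ range n, 1 / ((k : ℝ) + 1) ^ r

@[simp]
lemma genHarmonic_zero (r : ℕ) : genHarmonic r 0 = 0 := by simp [genHarmonic]

lemma genHarmonic_succ (r n : ℕ) :
    genHarmonic r (n + 1) = genHarmonic r n + 1 / ((n : ℝ) + 1) ^ r := by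
  simp [genHarmonic, sum_range_succ]

/-- The Cauchy product of two sequences. -/
def conv (f g : ℕ → ℝ) (n : ℕ) : ℝ := ∑ p ∈ antidiagonal n, f p.1 * g p.2

/-- Differencing a Cauchy product differences one of its factors, if that factor starts at `0`. -/
lemma conv_succ_sub {f : ℕ → ℝ} (hf : f 0 = 0) (g : ℕ → ℝ) (n : ℕ) :
    conv f g (n + 1) - conv f g n = conv (fun i ↦ f (i + 1) - f i) g n := by
  simp [conv, Nat.sum_antidiagonal_succ, hf, ← sum_sub_distrib, sub_mul]

lemma conv_comm (f g : ℕ → ℝ) (n : ℕ) : conv f g n = conv g f n := by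
  rw [conv, conv, ← Nat.sum_antidiagonal_swap]
  simp [mul_comm]

lemma conv_const_mul (c : ℝ) (f g : ℕ → ℝ) (n : ℕ) :
    conv (fun i ↦ c * f i) g n = c * conv f g n := by
  simp [conv, mul_sum, mul_assoc]

/-- The mean external path length of a random binary search tree with `n` leaves. -/
noncomputable def pathMean (n : ℕ) : ℝ := 2 * n * (genHarmonic 1 n - 1)

@[simp]
lemma pathMean_zero : pathMean 0 = 0 := by simp [pathMean]

lemma pathMean_succ_sub (n : ℕ) : pathMean (n + 1) - pathMean n = 2 * genHarmonic 1 n := by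
  have : (n : ℝ) + 1 ≠ 0 := by positivity
  simp only [pathMean, genHarmonic_succ]
  push_cast
  field_simp
  ring

/-- A partial fraction decomposition of the summands. -/
lemma conv_inv_inv (n : ℕ) :
    conv (fun i ↦ 1 / ((i : ℝ) + 1)) (fun i ↦ 1 / ((i : ℝ) + 1)) n =
      2 * genHarmonic 1 (n + 1) / (n + 2) := by
  have h1 : ∀ p ∈ antidiagonal n, 1 / ((p.1 : ℝ) + 1) * (1 / ((p.2 : ℝ) + 1)) =
      1 / (n + 2) * (1 / ((p.1 : ℝ) + 1) + 1 / ((p.2 : ℝ) + 1)) := by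
    intro p hp
    rw [HasAntidiagonal.mem_antidiagonal] at hp
    have : (n : ℝ) = p.1 + p.2 := by exact_mod_cast hp.symm
    rw [this]
    field_simp
    ring
  have h2 : ∑ p ∈ antidiagonal n, 1 / ((p.1 : ℝ) + 1) = genHarmonic 1 (n + 1) := by
    rw [Nat.sum_antidiagonal_eq_sum_range_succ_mk]
    simp [genHarmonic]
  have h3 : ∑ p ∈ antidiagonal n, 1 / ((p.2 : ℝ) + 1) = genHarmonic 1 (n + 1) := by
    rw [← h2, ← Nat.sum_antidiagonal_swap]
    simp
  rw [conv, sum_congr rfl h1, ← mul_sum, sum_add_distrib, h2, h3]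
  ring

lemma conv_inv_harmonic (n : ℕ) :
    conv (fun i ↦ 1 / ((i : ℝ) + 1)) (genHarmonic 1) n =
      genHarmonic 1 (n + 1) ^ 2 - genHarmonic 2 (n + 1) := by
  rw [conv_comm]
  induction n with
  | zero => simp [conv, genHarmonic_succ]
  | succ n ih =>
    have h := conv_succ_sub (genHarmonic_zero 1) (fun i : ℕ ↦ 1 / ((i : ℝ) + 1)) n
    have e : (fun i ↦ genHarmonic 1 (i + 1) - genHarmonic 1 i) =
        fun i : ℕ ↦ 1 / ((i : ℝ) + 1) := by
      funext i; rw [genHarmonic_succ]; simp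
    rw [e, conv_inv_inv] at h
    rw [eq_add_of_sub_eq h, ih, genHarmonic_succ 1 (n + 1), genHarmonic_succ 2 (n + 1)]
    push_cast
    field_simp
    ring

lemma conv_harmonic_harmonic (n : ℕ) :
    conv (genHarmonic 1) (genHarmonic 1) n =
      (n + 1) * (genHarmonic 1 n ^ 2 - genHarmonic 2 n) - 2 * n * genHarmonic 1 n + 2 * n := by
  induction n with
  | zero => simp [conv]
  | succ n ih =>
    have h := conv_succ_sub (genHarmonic_zero 1) (genHarmonic 1) n
    have e : (fun i ↦ genHarmonic 1 (i + 1) - genHarmonic 1 i) =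
        fun i : ℕ ↦ 1 / ((i : ℝ) + 1) := by
      funext i; rw [genHarmonic_succ]; simp
    rw [e, conv_inv_harmonic] at h
    rw [eq_add_of_sub_eq h, ih, genHarmonic_succ 1 n, genHarmonic_succ 2 n]
    push_cast
    field_simp
    ring

lemma conv_pathMean_harmonic (n : ℕ) :
    conv pathMean (genHarmonic 1) n =
      n * (n + 1) * (genHarmonic 1 n ^ 2 - genHarmonic 2 n)
        - n * (3 * n + 1) * genHarmonic 1 n + n * (7 * n + 1) / 2 := by
  induction n with
  | zero => simp [conv]
  | succ n ih =>
    have h := conv_succ_sub pathMean_zero (genHarmonic 1) n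
    rw [funext pathMean_succ_sub, conv_const_mul, conv_harmonic_harmonic] at h
    rw [eq_add_of_sub_eq h, ih, genHarmonic_succ 1 n, genHarmonic_succ 2 n]
    push_cast
    field_simp
    ring

lemma conv_pathMean_pathMean (n : ℕ) :
    conv pathMean pathMean n =
      2 / 3 * (n ^ 3 - n) * (genHarmonic 1 n ^ 2 - genHarmonic 2 n)
        + (-22 / 9 * n ^ 3 + 4 / 3 * n ^ 2 + 10 / 9 * n) * genHarmonic 1 n
        + (85 / 27 * n ^ 3 - 22 / 9 * n ^ 2 - 19 / 27 * n) := by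
  induction n with
  | zero => simp [conv]
  | succ n ih =>
    have h := conv_succ_sub pathMean_zero pathMean n
    rw [funext pathMean_succ_sub, conv_const_mul, conv_comm (genHarmonic 1),
      conv_pathMean_harmonic] at h
    rw [eq_add_of_sub_eq h, ih, genHarmonic_succ 1 n, genHarmonic_succ 2 n]
    push_cast
    field_simp
    ring

lemma sum_pathMean (n : ℕ) :
    ∑ i ∈ range n, pathMean (i + 1) = (n ^ 2 + n) * genHarmonic 1 n - (3 * n ^ 2 + n) / 2 := by
  induction n with
  | zero => simp
  | succ n ih =>
    rw [sum_range_succ, ih, pathMean, genHarmonic_succ 1 n]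
    push_cast
    field_simp
    ring

/-- The variance of the external path length of a random binary search tree with `n` leaves. -/
noncomputable def pathVar (n : ℕ) : ℝ :=
  7 * n ^ 2 - n - 4 * n ^ 2 * genHarmonic 2 n - 2 * n * genHarmonic 1 n

lemma sum_pathVar_add (n : ℕ) :
    ∑ i ∈ range n, (pathVar (i + 1) + pathMean (i + 1) ^ 2 - pathMean (i + 1)) =
      (4 / 3 * n ^ 3 + 2 * n ^ 2 + 2 / 3 * n) * (genHarmonic 1 n ^ 2 - genHarmonic 2 n)
        - (32 / 9 * n ^ 3 + 16 / 3 * n ^ 2 + 28 / 9 * n) * genHarmonic 1 n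
        + (131 / 27 * n ^ 3 + 58 / 9 * n ^ 2 + 19 / 27 * n) := by
  induction n with
  | zero => simp
  | succ n ih =>
    rw [sum_range_succ, ih, pathVar, pathMean, genHarmonic_succ 1 n, genHarmonic_succ 2 n]
    push_cast
    field_simp
    ring

/-! ### The distribution of the external path length of a random binary search tree -/

/-- The probability generating function of the external path length (the sum of the depths of
the leaves) of a random binary search tree with `m` inner nodes, hence `m + 1` leaves. The number
of inner nodes of the left subtree is uniform on `{0, …, m - 1}`, and the two subtrees are
attached at depth one, which adds `1` to the depth of each leaf. -/
noncomputable def depthPoly : ℕ → ℝ[X]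
  | 0 => 1
  | m + 1 => C (1 / ((m : ℝ) + 1)) * X ^ (m + 2) *
      ∑ i : Fin (m + 1), depthPoly i * depthPoly (m - i)

@[simp]
lemma depthPoly_zero : depthPoly 0 = 1 := by rw [depthPoly]

lemma depthPoly_succ (m : ℕ) :
    depthPoly (m + 1) = C (1 / ((m : ℝ) + 1)) * X ^ (m + 2) *
      ∑ p ∈ antidiagonal m, depthPoly p.1 * depthPoly p.2 := by
  rw [depthPoly, Nat.sum_antidiagonal_eq_sum_range_succ_mk, sum_range]

lemma succ_mul_depthPoly_succ (m : ℕ) :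
    C ((m : ℝ) + 1) * depthPoly (m + 1) =
      X ^ (m + 2) * ∑ p ∈ antidiagonal m, depthPoly p.1 * depthPoly p.2 := by
  have : (m : ℝ) + 1 ≠ 0 := by positivity
  rw [depthPoly_succ, ← mul_assoc, ← mul_assoc, ← C_mul, mul_one_div_cancel this, C_1, one_mul]

lemma depthPoly_coeff_nonneg (m k : ℕ) : 0 ≤ (depthPoly m).coeff k := by
  induction m using Nat.strong_induction_on generalizing k with
  | _ m ih =>
    rcases m with _ | m
    · rw [depthPoly_zero, coeff_one]; split_ifs <;> norm_num
    · rw [depthPoly_succ, mul_assoc, coeff_C_mul, coeff_X_pow_mul']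
      refine mul_nonneg (by positivity) ?_
      split_ifs
      · rw [finsetSum_coeff]
        refine sum_nonneg fun p hp ↦ ?_
        rw [HasAntidiagonal.mem_antidiagonal] at hp
        rw [coeff_mul]
        exact sum_nonneg fun q _ ↦ mul_nonneg (ih _ (by omega) _) (ih _ (by omega) _)
      · exact le_rfl

lemma depthPoly_eval_one (m : ℕ) : (depthPoly m).eval 1 = 1 := by
  induction m using Nat.strong_induction_on with
  | _ m ih =>
    rcases m with _ | m
    · simp
    · have h : ∑ p ∈ antidiagonal m, (depthPoly p.1).eval 1 * (depthPoly p.2).eval 1 =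
          (m : ℝ) + 1 := by
        rw [sum_congr rfl (g := fun _ ↦ (1 : ℝ))]
        · simp
        · intro p hp
          rw [HasAntidiagonal.mem_antidiagonal] at hp
          rw [ih _ (by omega), ih _ (by omega), one_mul]
      have : (m : ℝ) + 1 ≠ 0 := by positivity
      simp only [depthPoly_succ, eval_mul, eval_C, eval_pow, eval_X, one_pow, mul_one,
        eval_finsetSum, h]
      field_simp

lemma sum_antidiagonal_fst_eq (f : ℕ → ℝ) (m : ℕ) :
    ∑ p ∈ antidiagonal m, f p.1 = ∑ i ∈ range (m + 1), f i := by
  rw [Nat.sum_antidiagonal_eq_sum_range_succ_mk]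

lemma sum_antidiagonal_snd_eq (f : ℕ → ℝ) (m : ℕ) :
    ∑ p ∈ antidiagonal m, f p.2 = ∑ i ∈ range (m + 1), f i := by
  rw [← sum_antidiagonal_fst_eq, ← Nat.sum_antidiagonal_swap]
  simp

/-- Differentiating the recursion at `1` gives a linear recursion for the means, which
`pathMean` solves. -/
lemma depthPoly_derivative_eval_one (m : ℕ) :
    (derivative (depthPoly m)).eval 1 = pathMean (m + 1) := by
  induction m using Nat.strong_induction_on with
  | _ m ih =>
    rcases m with _ | m
    · simp [pathMean, genHarmonic_succ]
    · have h := congrArg (fun P ↦ (derivative P).eval 1) (succ_mul_depthPoly_succ m)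
      simp only [derivative_mul, derivative_C, zero_mul, zero_add, derivative_X_pow, eval_add,
        eval_mul, eval_C, eval_pow, eval_X, one_pow, mul_one, one_mul, eval_finsetSum,
        depthPoly_eval_one, derivative_sum, sum_const, Nat.card_antidiagonal,
        sum_add_distrib, nsmul_eq_mul] at h
      rw [sum_antidiagonal_fst_eq (fun i ↦ (derivative (depthPoly i)).eval 1),
        sum_antidiagonal_snd_eq (fun i ↦ (derivative (depthPoly i)).eval 1),
        sum_congr rfl fun i hi ↦ ih i (mem_range.1 hi), sum_pathMean] at h
      have h0 : (m : ℝ) + 1 ≠ 0 := by positivity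
      apply mul_left_cancel₀ h0
      rw [h, pathMean, genHarmonic_succ 1 (m + 1)]
      push_cast
      field_simp
      ring

lemma sum_antidiagonal_pathMean_mul (m : ℕ) :
    ∑ p ∈ antidiagonal m, pathMean (p.1 + 1) * pathMean (p.2 + 1) =
      conv pathMean pathMean (m + 2) := by
  rw [conv, Nat.sum_antidiagonal_succ, Nat.sum_antidiagonal_succ']
  simp

/-- The second derivative at `1` is the second factorial moment. Its recursion is linear, with the
self-convolution of the means in the inhomogeneous term. -/
lemma depthPoly_derivative_derivative_eval_one (m : ℕ) :
    (derivative (derivative (depthPoly m))).eval 1 =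
      pathVar (m + 1) + pathMean (m + 1) ^ 2 - pathMean (m + 1) := by
  induction m using Nat.strong_induction_on with
  | _ m ih =>
    rcases m with _ | m
    · simp [pathMean, pathVar, genHarmonic_succ]
      norm_num
    · have h := congrArg (fun P ↦ (derivative (derivative P)).eval 1)
        (succ_mul_depthPoly_succ m)
      simp only [derivative_mul, derivative_C, zero_mul, zero_add, derivative_X_pow, eval_add,
        eval_mul, eval_C, eval_pow, eval_X, one_pow, mul_one, one_mul, eval_finsetSum,
        depthPoly_eval_one, derivative_sum, sum_const, Nat.card_antidiagonal,
        sum_add_distrib, nsmul_eq_mul, derivative_add,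
        depthPoly_derivative_eval_one] at h
      rw [sum_antidiagonal_fst_eq (fun i ↦ (derivative (derivative (depthPoly i))).eval 1),
        sum_antidiagonal_snd_eq (fun i ↦ (derivative (derivative (depthPoly i))).eval 1),
        sum_antidiagonal_fst_eq (fun i ↦ pathMean (i + 1)),
        sum_antidiagonal_snd_eq (fun i ↦ pathMean (i + 1)),
        sum_congr rfl fun i hi ↦ ih i (mem_range.1 hi), sum_pathMean,
        sum_antidiagonal_pathMean_mul, conv_pathMean_pathMean, sum_pathVar_add] at h
      have h0 : (m : ℝ) + 1 ≠ 0 := by positivity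
      apply mul_left_cancel₀ h0
      rw [h, pathVar, pathMean, genHarmonic_succ 1 (m + 1), genHarmonic_succ 2 (m + 1)]
      push_cast
      field_simp
      ring

/-- The mean of the distribution with generating function `depthPoly m`. -/
lemma depthPoly_sum_mul (m : ℕ) :
    ((depthPoly m).sum fun k c ↦ c * (k : ℝ)) = pathMean (m + 1) := by
  rw [← depthPoly_derivative_eval_one, derivative_eval]
  simp

/-- The second moment of the distribution with generating function `depthPoly m`. -/
lemma depthPoly_sum_mul_sq (m : ℕ) :
    ((depthPoly m).sum fun k c ↦ c * (k : ℝ) ^ 2) =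
      pathVar (m + 1) + pathMean (m + 1) ^ 2 := by
  have h2 := depthPoly_derivative_derivative_eval_one m
  have h3 : (derivative (X * derivative (depthPoly m))).eval 1 =
      (depthPoly m).sum fun k c ↦ c * (k : ℝ) ^ 2 := by
    induction depthPoly m using Polynomial.induction_on' with
    | add p q hp hq =>
      rw [sum_add_index _ _ _ (by simp) (by intros; ring), ← hp, ← hq]
      simp [mul_add]
    | monomial n a =>
      rw [sum_monomial_index _ _ (by simp)]
      rcases n with _ | n
      · simp
      · simp [eval_monomial]
        ring
  rw [← h3, derivative_mul, derivative_X, eval_add, eval_mul, eval_mul, h2,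
    depthPoly_derivative_eval_one]
  simp

lemma depthPoly_sum_coeff (m : ℕ) : ((depthPoly m).sum fun _ c ↦ c) = 1 := by
  rw [← depthPoly_eval_one m, eval_eq_sum]
  simp

/-! ### Asymptotics of the variance -/

lemma tendsto_genHarmonic_two :
    Tendsto (genHarmonic 2) atTop (𝓝 (Real.pi ^ 2 / 6)) := by
  have h := (hasSum_nat_add_iff' 1).2 hasSum_zeta_two
  refine (h.tendsto_sum_nat.congr fun n ↦ ?_).trans_eq (by simp)
  simp [genHarmonic]

lemma genHarmonic_one_eq_harmonic (n : ℕ) : genHarmonic 1 n = (harmonic n : ℝ) := by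
  simp [genHarmonic, harmonic]

lemma tendsto_genHarmonic_one_div :
    Tendsto (fun n : ℕ ↦ genHarmonic 1 n / n) atTop (𝓝 0) := by
  have h1 : Tendsto (fun n : ℕ ↦ (1 + Real.log n) / (n : ℝ)) atTop (𝓝 0) := by
    have h2 : Tendsto (fun x : ℝ ↦ (1 + Real.log x) / x) atTop (𝓝 0) := by
      have h3 := (tendsto_inv_atTop_zero (𝕜 := ℝ)).add
        (Real.isLittleO_log_id_atTop.tendsto_div_nhds_zero)
      rw [add_zero] at h3
      refine h3.congr fun x ↦ ?_
      rw [add_div, one_div]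
      rfl
    exact h2.comp tendsto_natCast_atTop_atTop
  refine squeeze_zero (fun n ↦ ?_) (fun n ↦ ?_) h1
  · exact div_nonneg (sum_nonneg fun k _ ↦ by positivity) (by positivity)
  · rw [genHarmonic_one_eq_harmonic]
    gcongr
    exact harmonic_le_one_add_log n

lemma tendsto_pathVar_div_sq :
    Tendsto (fun n : ℕ ↦ pathVar (n + 1) / ((n : ℝ) + 1) ^ 2) atTop
      (𝓝 (7 - 2 / 3 * Real.pi ^ 2)) := by
  have h1 : Tendsto (fun n : ℕ ↦ 7 - 1 / (n : ℝ) - 4 * genHarmonic 2 n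
      - 2 * (genHarmonic 1 n / n)) atTop (𝓝 (7 - 0 - 4 * (Real.pi ^ 2 / 6) - 2 * 0)) :=
    ((tendsto_const_nhds.sub tendsto_one_div_atTop_nhds_zero_nat).sub
      (tendsto_genHarmonic_two.const_mul 4)).sub (tendsto_genHarmonic_one_div.const_mul 2)
  have h2 := (tendsto_add_atTop_iff_nat 1).2 h1
  convert h2 using 2 with n
  · rw [pathVar]
    push_cast
    field_simp
  · ring

lemma pathMean_nonneg (n : ℕ) : 0 ≤ pathMean n := by
  rcases n with _ | n
  · simp
  · have : 1 ≤ genHarmonic 1 (n + 1) := by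
      rw [genHarmonic, sum_range_succ']
      simp only [pow_one, CharP.cast_eq_zero, zero_add, div_one, le_add_iff_nonneg_left]
      exact sum_nonneg fun k _ ↦ by positivity
    exact mul_nonneg (by positivity) (by linarith)

lemma pathMean_le (n : ℕ) : pathMean n ≤ 2 * n * n := by
  have : genHarmonic 1 n ≤ n := by
    calc genHarmonic 1 n ≤ ∑ _k ∈ range n, (1 : ℝ) := sum_le_sum fun k _ ↦ by
          rw [pow_one, div_le_one (by positivity)]; linarith [(Nat.cast_nonneg k : (0 : ℝ) ≤ k)]
      _ = n := by simp
  unfold pathMean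
  gcongr
  linarith

end Moments

/-! ### The leaves as a random finite set -/

open Classical in
/-- The finite set of leaves at time `t`, with the value `∅` when there are infinitely many. -/
noncomputable def leafFinset (τ : List Bool → ℝ) (t : ℝ) : Finset (List Bool) :=
  if h : (leaves τ t).Finite then h.toFinset else ∅

lemma Z_eq_card (τ : List Bool → ℝ) (t : ℝ) : Z τ t = (leafFinset τ t).card := by
  rw [Z, leafFinset]
  split_ifs with h
  · exact Set.ncard_eq_toFinset_card _ h
  · exact Set.Infinite.ncard h

lemma G_eq_sum (τ : List Bool → ℝ) (t : ℝ) : G τ t = ∑ u ∈ leafFinset τ t, u.length := by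
  rw [G, leafFinset]
  split_ifs with h
  · exact finsum_mem_eq_finite_toFinset_sum _ h
  · refine finsum_mem_eq_zero_of_infinite ?_
    -- all leaves but the root have positive depth
    refine (Set.Infinite.sdiff h (Set.finite_singleton [])).mono fun u hu ↦ ⟨hu.1, ?_⟩
    simpa using hu.2

lemma measurable_birthTime (u : List Bool) :
    Measurable fun τ : List Bool → ℝ ↦ birthTime τ u :=
  Finset.measurable_sum _ fun _ _ ↦ measurable_pi_apply _

lemma measurableSet_mem_leaves (u : List Bool) :
    MeasurableSet {p : (List Bool → ℝ) × ℝ | u ∈ leaves p.1 p.2} := by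
  have h : Measurable fun p : (List Bool → ℝ) × ℝ ↦ birthTime p.1 u :=
    (measurable_birthTime u).comp measurable_fst
  exact (measurableSet_le h measurable_snd).inter
    (measurableSet_lt measurable_snd (h.add ((measurable_pi_apply u).comp measurable_fst)))

lemma measurableSet_leaves_eq (s : Set (List Bool)) :
    MeasurableSet {p : (List Bool → ℝ) × ℝ | leaves p.1 p.2 = s} := by
  have : {p : (List Bool → ℝ) × ℝ | leaves p.1 p.2 = s} =
      ⋂ u, {p | u ∈ leaves p.1 p.2 ↔ u ∈ s} := by
    ext p
    simp [Set.ext_iff]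
  rw [this]
  exact MeasurableSet.iInter fun u ↦ (measurableSet_mem_leaves u).iff (MeasurableSet.const _)

lemma measurableSet_leafFinset_eq (s : Finset (List Bool)) :
    MeasurableSet {p : (List Bool → ℝ) × ℝ | leafFinset p.1 p.2 = s} := by
  have hinf : MeasurableSet {p : (List Bool → ℝ) × ℝ | (leaves p.1 p.2).Finite} := by
    have : {p : (List Bool → ℝ) × ℝ | (leaves p.1 p.2).Finite} =
        ⋃ s : Finset (List Bool), {p | leaves p.1 p.2 = s} := by
      ext p
      simp only [Set.mem_ofPred_eq, Set.mem_iUnion]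
      exact ⟨fun h ↦ ⟨h.toFinset, by simp⟩, fun ⟨s, hs⟩ ↦ hs ▸ s.finite_toSet⟩
    rw [this]
    exact MeasurableSet.iUnion fun s ↦ measurableSet_leaves_eq _
  have : {p : (List Bool → ℝ) × ℝ | leafFinset p.1 p.2 = s} =
      {p | leaves p.1 p.2 = s} ∪ ({p | (leaves p.1 p.2).Finite}ᶜ ∩ {_p | s = ∅}) := by
    ext p
    simp only [Set.mem_ofPred_eq, Set.mem_union, Set.mem_inter_iff, Set.mem_compl_iff, leafFinset]
    split_ifs with h
    · rw [← Finset.coe_inj, Set.Finite.coe_toFinset]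
      simp [h]
    · have : leaves p.1 p.2 ≠ s := fun e ↦ h (e ▸ s.finite_toSet)
      simp [h, this, eq_comm]
  rw [this]
  exact (measurableSet_leaves_eq _).union (hinf.compl.inter (MeasurableSet.const _))

lemma measurable_comp_leafFinset {β : Type*} [MeasurableSpace β] (f : Finset (List Bool) → β) :
    Measurable fun p : (List Bool → ℝ) × ℝ ↦ f (leafFinset p.1 p.2) := by
  intro B _
  have : (fun p : (List Bool → ℝ) × ℝ ↦ f (leafFinset p.1 p.2)) ⁻¹' B =
      ⋃ s ∈ f ⁻¹' B, {p | leafFinset p.1 p.2 = s} := by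
    ext p
    simp
  rw [this]
  exact MeasurableSet.biUnion (Set.to_countable _) fun s _ ↦ measurableSet_leafFinset_eq s

lemma measurable_Z_G :
    Measurable fun p : (List Bool → ℝ) × ℝ ↦ (Z p.1 p.2, G p.1 p.2) := by
  simp only [Z_eq_card, G_eq_sum]
  exact measurable_comp_leafFinset fun s ↦ (s.card, ∑ u ∈ s, u.length)

/-! ### Decomposition of the tree at the root -/

/-- The waiting times in a tree with waiting time `r` at the root and the waiting times `f` and
`g` in the subtrees of the two children of the root. -/
def node (r : ℝ) (f g : List Bool → ℝ) : List Bool → ℝ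
  | [] => r
  | false :: u => f u
  | true :: u => g u

lemma birthTime_node_false (r : ℝ) (f g : List Bool → ℝ) (u : List Bool) :
    birthTime (node r f g) (false :: u) = r + birthTime f u := by
  simp [birthTime, Finset.sum_range_succ', node, add_comm]

lemma birthTime_node_true (r : ℝ) (f g : List Bool → ℝ) (u : List Bool) :
    birthTime (node r f g) (true :: u) = r + birthTime g u := by
  simp [birthTime, Finset.sum_range_succ', node, add_comm]

/-- Once the root has split, the leaves are those of its two subtrees. -/
lemma leaves_node {r t : ℝ} (hr : r ≤ t) (f g : List Bool → ℝ) :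
    leaves (node r f g) t =
      List.cons false '' leaves f (t - r) ∪ List.cons true '' leaves g (t - r) := by
  ext u
  rcases u with _ | ⟨_ | _, u⟩
  · simp [leaves, birthTime, node, hr]
  · simp only [leaves, Set.mem_ofPred_eq, birthTime_node_false, node, Set.mem_union, Set.mem_image,
      List.cons.injEq, true_and, exists_eq_right, reduceCtorEq, false_and, and_false,
      exists_const, or_false]
    constructor <;> rintro ⟨h1, h2⟩ <;> constructor <;> linarith
  · simp only [leaves, Set.mem_ofPred_eq, birthTime_node_true, node, Set.mem_union, Set.mem_image,
      List.cons.injEq, true_and, exists_eq_right, reduceCtorEq, false_and, and_false,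
      exists_const, false_or]
    constructor <;> rintro ⟨h1, h2⟩ <;> constructor <;> linarith

lemma leaves_eq_singleton {τ : List Bool → ℝ} (hτ : ∀ u, 0 ≤ τ u) {t : ℝ} (ht : 0 ≤ t)
    (h : t < τ []) : leaves τ t = {[]} := by
  ext u
  rcases u with _ | ⟨b, u⟩
  · simp [leaves, birthTime, ht, h]
  · have : τ [] ≤ birthTime τ (b :: u) := by
      have := Finset.single_le_sum (f := fun i ↦ τ ((b :: u).take i))
        (fun i _ ↦ hτ _) (Finset.mem_range.2 (Nat.succ_pos u.length))
      simpa [birthTime] using this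
    simp only [leaves, Set.mem_ofPred_eq, Set.mem_singleton_iff, reduceCtorEq, iff_false]
    intro h'
    linarith [h'.1]

lemma finite_leaves_of_Z_ne_zero {τ : List Bool → ℝ} {t : ℝ} (h : Z τ t ≠ 0) :
    (leaves τ t).Finite :=
  Set.finite_of_ncard_ne_zero h

/-- Each leaf of a subtree is one level deeper in the whole tree. The subtrees must have finitely
many leaves, which `Z ≠ 0` ensures. -/
lemma Z_G_node {r t : ℝ} (hr : r ≤ t) {f g : List Bool → ℝ}
    (hf : Z f (t - r) ≠ 0) (hg : Z g (t - r) ≠ 0) :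
    Z (node r f g) t = Z f (t - r) + Z g (t - r) ∧
      G (node r f g) t = G f (t - r) + G g (t - r) + (Z f (t - r) + Z g (t - r)) := by
  have hf' := finite_leaves_of_Z_ne_zero hf
  have hg' := finite_leaves_of_Z_ne_zero hg
  have hd : Disjoint (List.cons false '' leaves f (t - r))
      (List.cons true '' leaves g (t - r)) := by
    rw [Set.disjoint_left]
    rintro _ ⟨u, _, rfl⟩ ⟨v, _, h⟩
    simp at h
  have hsum : ∀ s : Set (List Bool), s.Finite →
      ∑ᶠ u ∈ s, (u.length + 1) = ∑ᶠ u ∈ s, u.length + s.ncard := by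
    intro s hs
    rw [finsum_mem_eq_finite_toFinset_sum _ hs, finsum_mem_eq_finite_toFinset_sum _ hs,
      Finset.sum_add_distrib, Set.ncard_eq_toFinset_card _ hs]
    simp
  constructor
  · rw [Z, leaves_node hr, Set.ncard_union_eq hd (hf'.image _) (hg'.image _),
      Set.ncard_image_of_injective _ List.cons_injective,
      Set.ncard_image_of_injective _ List.cons_injective, Z, Z]
  · rw [G, leaves_node hr, finsum_mem_union hd (hf'.image _) (hg'.image _),
      finsum_mem_image List.cons_injective.injOn, finsum_mem_image List.cons_injective.injOn]
    simp only [List.length_cons]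
    rw [hsum _ hf', hsum _ hg', G, G, Z, Z]
    ring

lemma measurable_node :
    Measurable fun p : ℝ × (List Bool → ℝ) × (List Bool → ℝ) ↦ node p.1 p.2.1 p.2.2 := by
  rw [measurable_pi_iff]
  rintro (_ | ⟨_ | _, u⟩) <;> simp only [node] <;> fun_prop

/-- The law of the waiting times of all nodes of the tree. -/
noncomputable def treeLaw (lam : ℝ) : Measure (List Bool → ℝ) :=
  Measure.infinitePi fun _ ↦ expMeasure lam

/-- A product over words splits into the empty word and the words with first letter `false` and
`true`. -/
lemma prod_words {M : Type*} [CommMonoid M] (s : Finset (List Bool)) (F : List Bool → M) :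
    ∏ u ∈ s, F u = (if [] ∈ s then F [] else 1) *
      ((∏ u ∈ s.preimage (List.cons false) List.cons_injective.injOn, F (false :: u)) *
        ∏ u ∈ s.preimage (List.cons true) List.cons_injective.injOn, F (true :: u)) := by
  classical
  have h : s = (s.filter (· = [])) ∪
      ((s.preimage (List.cons false) List.cons_injective.injOn).image (List.cons false) ∪
        (s.preimage (List.cons true) List.cons_injective.injOn).image (List.cons true)) := by
    ext u
    rcases u with _ | ⟨_ | _, u⟩ <;> simp
  conv_lhs => rw [h]
  rw [Finset.prod_union, Finset.prod_union, Finset.prod_image List.cons_injective.injOn,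
    Finset.prod_image List.cons_injective.injOn, Finset.prod_filter, Finset.prod_ite_eq']
  · rw [Finset.disjoint_left]
    simp
  · rw [Finset.disjoint_left]
    simp only [Finset.mem_filter, Finset.mem_union, Finset.mem_image, and_imp]
    rintro _ _ rfl
    simp

/-- The waiting times in the tree are those of the root and of two independent subtrees that are
distributed like the whole tree. -/
lemma map_node_treeLaw {lam : ℝ} (hlam : 0 < lam) :
    ((expMeasure lam).prod ((treeLaw lam).prod (treeLaw lam))).map
      (fun p ↦ node p.1 p.2.1 p.2.2) = treeLaw lam := by
  have := isProbabilityMeasure_expMeasure hlam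
  have : IsProbabilityMeasure (treeLaw lam) := by unfold treeLaw; infer_instance
  refine Measure.eq_infinitePi _ fun s A hA ↦ ?_
  rw [Measure.map_apply measurable_node (MeasurableSet.pi s.countable_toSet fun i _ ↦ hA i)]
  have : (fun p : ℝ × (List Bool → ℝ) × (List Bool → ℝ) ↦ node p.1 p.2.1 p.2.2) ⁻¹'
      (Set.pi s A) = (if [] ∈ s then A [] else Set.univ) ×ˢ
      ((Set.pi (s.preimage (List.cons false) List.cons_injective.injOn)
          fun u ↦ A (false :: u)) ×ˢ
        (Set.pi (s.preimage (List.cons true) List.cons_injective.injOn)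
          fun u ↦ A (true :: u))) := by
    ext ⟨r, f, g⟩
    simp only [Set.mem_preimage, Set.mem_pi, Set.mem_prod, Finset.mem_coe, Finset.mem_preimage]
    constructor
    · intro h
      refine ⟨?_, fun u hu ↦ h (false :: u) hu, fun u hu ↦ h (true :: u) hu⟩
      split_ifs with h0
      · exact h [] h0
      · trivial
    · rintro ⟨h0, h1, h2⟩ (_ | ⟨_ | _, u⟩) hu
      · rw [if_pos (by exact hu)] at h0
        exact h0
      · exact h1 u hu
      · exact h2 u hu
  rw [this, Measure.prod_prod, Measure.prod_prod, treeLaw,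
    Measure.infinitePi_pi _ fun i _ ↦ hA _, Measure.infinitePi_pi _ fun i _ ↦ hA _,
    prod_words s]
  split_ifs <;> simp

/-! ### The joint law of the number of leaves and the sum of their depths -/

/-- The probability that there are `m + 1` leaves at time `t`. -/
noncomputable def leafProb (lam t : ℝ) (m : ℕ) : ℝ :=
  Real.exp (-(lam * t)) * (1 - Real.exp (-(lam * t))) ^ m

lemma one_sub_exp_nonneg {lam t : ℝ} (hlam : 0 < lam) (ht : 0 ≤ t) :
    0 ≤ 1 - Real.exp (-(lam * t)) := by
  have : Real.exp (-(lam * t)) ≤ 1 :=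
    Real.exp_le_one_iff.2 (by have := mul_nonneg hlam.le ht; linarith)
  linarith

lemma one_sub_exp_lt_one (lam t : ℝ) : 1 - Real.exp (-(lam * t)) < 1 := by
  linarith [Real.exp_pos (-(lam * t))]

lemma leafProb_nonneg {lam t : ℝ} (hlam : 0 < lam) (ht : 0 ≤ t) (m : ℕ) :
    0 ≤ leafProb lam t m :=
  mul_nonneg (Real.exp_pos _).le (pow_nonneg (one_sub_exp_nonneg hlam ht) m)

lemma hasSum_leafProb {lam t : ℝ} (hlam : 0 < lam) (ht : 0 ≤ t) :
    HasSum (leafProb lam t) 1 := by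
  have h := (hasSum_geometric_of_lt_one (one_sub_exp_nonneg hlam ht)
    (one_sub_exp_lt_one lam t)).mul_left (Real.exp (-(lam * t)))
  rwa [sub_sub_cancel, mul_inv_cancel₀ (Real.exp_pos _).ne'] at h

instance {lam : ℝ} [Fact (0 < lam)] : IsProbabilityMeasure (expMeasure lam) :=
  isProbabilityMeasure_expMeasure Fact.out

instance {lam : ℝ} [Fact (0 < lam)] : IsProbabilityMeasure (treeLaw lam) := by
  unfold treeLaw; infer_instance

lemma expMeasure_Iic {lam : ℝ} (hlam : 0 < lam) {t : ℝ} (ht : 0 ≤ t) :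
    expMeasure lam (Set.Iic t) = ENNReal.ofReal (1 - Real.exp (-(lam * t))) := by
  rw [expMeasure, gammaMeasure, withDensity_apply _ measurableSet_Iic]
  have := lintegral_exponentialPDF_eq_antiDeriv hlam t
  rwa [if_pos ht] at this

lemma expMeasure_Ioi {lam : ℝ} (hlam : 0 < lam) {t : ℝ} (ht : 0 ≤ t) :
    expMeasure lam (Set.Ioi t) = ENNReal.ofReal (Real.exp (-(lam * t))) := by
  have := isProbabilityMeasure_expMeasure hlam
  rw [← Set.compl_Iic, prob_compl_eq_one_sub measurableSet_Iic, expMeasure_Iic hlam ht,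
    ← ENNReal.ofReal_one, ← ENNReal.ofReal_sub _ (one_sub_exp_nonneg hlam ht), sub_sub_cancel]

lemma setLIntegral_expMeasure {lam : ℝ} (hlam : 0 < lam) {t : ℝ} (ht : 0 ≤ t) {h : ℝ → ℝ}
    (hc : Continuous h) (h0 : ∀ r ∈ Set.Ioc 0 t, 0 ≤ h r) :
    ∫⁻ r in Set.Ioc 0 t, ENNReal.ofReal (h r) ∂(expMeasure lam) =
      ENNReal.ofReal (∫ r in 0..t, lam * Real.exp (-(lam * r)) * h r) := by
  have hm : Measurable (exponentialPDF lam) :=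
    (measurable_exponentialPDFReal lam).ennreal_ofReal
  have hi : IntegrableOn (fun r ↦ lam * Real.exp (-(lam * r)) * h r) (Set.Ioc 0 t) volume := by
    have : Continuous fun r ↦ lam * Real.exp (-(lam * r)) * h r := by fun_prop
    exact this.integrableOn_Ioc
  rw [expMeasure, gammaMeasure, restrict_withDensity measurableSet_Ioc,
    show gammaPDF 1 lam = exponentialPDF lam from rfl,
    lintegral_withDensity_eq_lintegral_mul _ hm (by fun_prop),
    intervalIntegral.integral_of_le ht, ofReal_integral_eq_lintegral_ofReal hi]
  · refine setLIntegral_congr_fun measurableSet_Ioc fun r hr ↦ ?_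
    rw [Pi.mul_apply, exponentialPDF_of_nonneg hr.1.le, ← ENNReal.ofReal_mul (by positivity)]
  · refine (ae_restrict_iff' measurableSet_Ioc).2 (ae_of_all _ fun r hr ↦ ?_)
    exact mul_nonneg (by positivity) (h0 r hr)

/-- Two subtrees that start at the exponential time `r` have `m + 2` leaves in total at time `t`
with the probability `leafProb lam t (m + 1)`: given `r`, each of the `m + 1` ways to distribute
the leaves has the same probability, and this is the integral over `r` for one of them. -/
lemma integral_leafProb_step (lam t : ℝ) (m : ℕ) :
    ∫ r in 0..t, lam * Real.exp (-(lam * r)) *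
        (Real.exp (-(lam * (t - r))) ^ 2 * (1 - Real.exp (-(lam * (t - r)))) ^ m) =
      leafProb lam t (m + 1) / (m + 1) := by
  have hm : (m : ℝ) + 1 ≠ 0 := by positivity
  have hd : ∀ r ∈ Set.uIcc 0 t, HasDerivAt (fun r ↦ -(Real.exp (-(lam * t)) *
      (1 - Real.exp (-(lam * (t - r)))) ^ (m + 1) / (m + 1)))
      (lam * Real.exp (-(lam * r)) *
        (Real.exp (-(lam * (t - r))) ^ 2 * (1 - Real.exp (-(lam * (t - r)))) ^ m)) r := by
    intro r _
    have h1 : HasDerivAt (fun r ↦ -(lam * (t - r))) lam r := by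
      simpa using (((hasDerivAt_id' r).const_sub t).const_mul lam).fun_neg
    have h2 := ((((h1.exp.const_sub 1).pow (m + 1)).const_mul
      (Real.exp (-(lam * t)))).div_const ((m : ℝ) + 1)).neg
    refine h2.congr_deriv ?_
    have h3 : Real.exp (-(lam * t)) =
        Real.exp (-(lam * r)) * Real.exp (-(lam * (t - r))) := by
      rw [← Real.exp_add]; ring_nf
    rw [h3]
    simp only [Nat.add_sub_cancel]
    push_cast
    field_simp
  rw [intervalIntegral.integral_eq_sub_of_hasDerivAt hd
    (Continuous.intervalIntegrable (by fun_prop) _ _)]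
  simp [leafProb]

/-- The event that the tree has `m + 1` leaves at time `t` and that their depths sum to `k`. -/
def treeEvent (t : ℝ) (m k : ℕ) : Set (List Bool → ℝ) := {x | Z x t = m + 1 ∧ G x t = k}

lemma measurableSet_treeEvent (t : ℝ) (m k : ℕ) : MeasurableSet (treeEvent t m k) := by
  have h : Measurable fun x : List Bool → ℝ ↦ (Z x t, G x t) :=
    measurable_Z_G.comp (f := fun x : List Bool → ℝ ↦ (x, t)) measurable_prodMk_right
  exact (h.fst (measurableSet_singleton (m + 1))).inter (h.snd (measurableSet_singleton k))

lemma ae_treeLaw_nonneg {lam : ℝ} [Fact (0 < lam)] :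
    ∀ᵐ x ∂treeLaw lam, ∀ u, 0 ≤ x u := by
  rw [ae_all_iff]
  intro u
  have h : ∀ᵐ r ∂expMeasure lam, 0 ≤ r := by
    have := expMeasure_Ioi (lam := lam) Fact.out le_rfl
    simp only [mul_zero, neg_zero, Real.exp_zero, ENNReal.ofReal_one] at this
    have h' : ∀ᵐ r ∂expMeasure lam, r ∈ Set.Ioi (0 : ℝ) :=
      (mem_ae_iff_prob_eq_one measurableSet_Ioi).2 this
    exact h'.mono fun r hr ↦ le_of_lt hr
  rw [← Measure.infinitePi_map_eval (fun _ : List Bool ↦ expMeasure lam) u] at h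
  exact ae_of_ae_map (measurable_pi_apply u).aemeasurable h

lemma le_treeLaw_treeEvent_zero {lam : ℝ} [hlam : Fact (0 < lam)] {t : ℝ} (ht : 0 ≤ t) :
    ENNReal.ofReal (leafProb lam t 0) ≤ treeLaw lam (treeEvent t 0 0) := by
  have h1 : treeLaw lam {x | t < x []} = ENNReal.ofReal (leafProb lam t 0) := by
    rw [leafProb, pow_zero, mul_one, ← expMeasure_Ioi hlam.out ht,
      ← Measure.infinitePi_map_eval (fun _ : List Bool ↦ expMeasure lam) [],
      Measure.map_apply (measurable_pi_apply _) measurableSet_Ioi]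
    rfl
  rw [← h1]
  refine measure_mono_ae ?_
  filter_upwards [ae_treeLaw_nonneg (lam := lam)] with x hx hxt
  have := leaves_eq_singleton hx ht hxt
  change Z x t = 0 + 1 ∧ G x t = 0
  simp [Z, G, this]

/-- If the lower bounds for the probabilities of the events `treeEvent s i j` hold for `i ≤ m`,
then two independent trees have `m + 2` leaves in total, with depths summing to `k`, with at least
the probability that corresponds to the Cauchy product of the generating functions. -/
lemma le_prod_treeLaw {lam : ℝ} [hlam : Fact (0 < lam)] {m k : ℕ} {s : ℝ} (hs : 0 ≤ s)
    (ih : ∀ i ≤ m, ∀ j, ENNReal.ofReal (leafProb lam s i * (depthPoly i).coeff j) ≤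
      treeLaw lam (treeEvent s i j)) :
    ENNReal.ofReal ((Real.exp (-(lam * s)) ^ 2 * (1 - Real.exp (-(lam * s))) ^ m) *
      (∑ p ∈ Finset.HasAntidiagonal.antidiagonal m, depthPoly p.1 * depthPoly p.2).coeff k) ≤
    ((treeLaw lam).prod (treeLaw lam)) (⋃ a ∈
      Finset.HasAntidiagonal.antidiagonal m ×ˢ Finset.HasAntidiagonal.antidiagonal k,
        treeEvent s a.1.1 a.2.1 ×ˢ treeEvent s a.1.2 a.2.2) := by
  rw [measure_biUnion_finset]
  · have h : (Real.exp (-(lam * s)) ^ 2 * (1 - Real.exp (-(lam * s))) ^ m) *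
        (∑ p ∈ Finset.HasAntidiagonal.antidiagonal m, depthPoly p.1 * depthPoly p.2).coeff k =
        ∑ a ∈ Finset.HasAntidiagonal.antidiagonal m ×ˢ Finset.HasAntidiagonal.antidiagonal k,
          (leafProb lam s a.1.1 * (depthPoly a.1.1).coeff a.2.1) *
            (leafProb lam s a.1.2 * (depthPoly a.1.2).coeff a.2.2) := by
      rw [Polynomial.finsetSum_coeff, Finset.mul_sum, Finset.sum_product]
      refine Finset.sum_congr rfl fun p hp ↦ ?_
      rw [Polynomial.coeff_mul, Finset.mul_sum]
      refine Finset.sum_congr rfl fun q _ ↦ ?_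
      rw [Finset.HasAntidiagonal.mem_antidiagonal] at hp
      rw [leafProb, leafProb, ← hp, pow_add]
      ring
    have hnn : ∀ i j, 0 ≤ leafProb lam s i * (depthPoly i).coeff j := fun i j ↦
      mul_nonneg (leafProb_nonneg hlam.out hs i) (depthPoly_coeff_nonneg i j)
    rw [h, ENNReal.ofReal_sum_of_nonneg fun a _ ↦ mul_nonneg (hnn _ _) (hnn _ _)]
    refine Finset.sum_le_sum fun a ha ↦ ?_
    rw [Finset.mem_product, Finset.HasAntidiagonal.mem_antidiagonal] at ha
    rw [Measure.prod_prod, ENNReal.ofReal_mul (hnn _ _)]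
    exact mul_le_mul' (ih _ (by omega) _) (ih _ (by omega) _)
  · rintro ⟨⟨i, i'⟩, j, j'⟩ _ ⟨⟨l, l'⟩, n, n'⟩ _ hne
    refine Set.disjoint_left.2 ?_
    rintro ⟨f, g⟩ ⟨⟨h1, h2⟩, h3, h4⟩ ⟨⟨h5, h6⟩, h7, h8⟩
    simp only [Prod.mk.injEq, ne_eq] at hne h1 h2 h3 h4 h5 h6 h7 h8
    omega
  · exact fun a _ ↦ (measurableSet_treeEvent _ _ _).prod (measurableSet_treeEvent _ _ _)

/-- Only a lower bound is proved by decomposing the tree at its root, because the two subtrees are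
not known to be almost surely finite and non-empty: an infinite set of leaves has `Z = 0`, and then
`Z` need not be additive over the subtrees. The bound is an equality by `treeLaw_treeEvent`. -/
lemma le_treeLaw_treeEvent {lam : ℝ} [hlam : Fact (0 < lam)] (m : ℕ) {t : ℝ} (ht : 0 ≤ t)
    (k : ℕ) :
    ENNReal.ofReal (leafProb lam t m * (depthPoly m).coeff k) ≤
      treeLaw lam (treeEvent t m k) := by
  induction m using Nat.strong_induction_on generalizing t k with
  | _ m ih =>
    rcases m with _ | m
    · rw [depthPoly_zero, Polynomial.coeff_one]
      split_ifs with h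
      · rw [h, mul_one]
        exact le_treeLaw_treeEvent_zero ht
      · simp
    rw [depthPoly_succ, mul_assoc, Polynomial.coeff_C_mul, Polynomial.coeff_X_pow_mul']
    split_ifs with hk
    swap
    · simp
    obtain ⟨k, rfl⟩ := Nat.exists_eq_add_of_le hk
    rw [Nat.add_sub_cancel_left]
    set c := (∑ p ∈ Finset.HasAntidiagonal.antidiagonal m,
      depthPoly p.1 * depthPoly p.2).coeff k with hc
    have hc0 : 0 ≤ c := by
      rw [hc, Polynomial.finsetSum_coeff]
      refine Finset.sum_nonneg fun p _ ↦ ?_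
      rw [Polynomial.coeff_mul]
      exact Finset.sum_nonneg fun q _ ↦
        mul_nonneg (depthPoly_coeff_nonneg _ _) (depthPoly_coeff_nonneg _ _)
    -- the root splits at time `r ≤ t`, and the two subtrees then have time `t - r` to grow
    have hsub : ∀ r ∈ Set.Ioc 0 t,
        ENNReal.ofReal ((Real.exp (-(lam * (t - r))) ^ 2 *
          (1 - Real.exp (-(lam * (t - r)))) ^ m) * c) ≤
        ((treeLaw lam).prod (treeLaw lam)) (Prod.mk r ⁻¹'
          ((fun p : ℝ × (List Bool → ℝ) × (List Bool → ℝ) ↦ node p.1 p.2.1 p.2.2) ⁻¹'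
            treeEvent t (m + 1) (m + 2 + k))) := by
      intro r hr
      refine (le_prod_treeLaw (sub_nonneg.2 hr.2)
        fun i hi j ↦ ih i (by omega) (sub_nonneg.2 hr.2) j).trans (measure_mono ?_)
      rintro ⟨f, g⟩ h
      simp only [Set.mem_iUnion, Set.mem_prod, Finset.mem_product,
        Finset.HasAntidiagonal.mem_antidiagonal, exists_prop] at h
      obtain ⟨⟨⟨i, i'⟩, j, j'⟩, ⟨hi, hj⟩, ⟨hf1, hf2⟩, hg1, hg2⟩ := h
      simp only at hi hj hf1 hf2 hg1 hg2
      obtain ⟨hZ, hG⟩ := Z_G_node hr.2 (f := f) (g := g) (by omega) (by omega)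
      change Z (node r f g) t = m + 1 + 1 ∧ G (node r f g) t = m + 2 + k
      omega
    have hmeas : MeasurableSet
        ((fun p : ℝ × (List Bool → ℝ) × (List Bool → ℝ) ↦ node p.1 p.2.1 p.2.2) ⁻¹'
          treeEvent t (m + 1) (m + 2 + k)) :=
      measurable_node (measurableSet_treeEvent _ _ _)
    calc ENNReal.ofReal (leafProb lam t (m + 1) * (1 / ((m : ℝ) + 1) * c))
        = ENNReal.ofReal (∫ r in 0..t, lam * Real.exp (-(lam * r)) *
            ((Real.exp (-(lam * (t - r))) ^ 2 *
              (1 - Real.exp (-(lam * (t - r)))) ^ m) * c)) := by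
          simp_rw [← mul_assoc _ _ c]
          rw [intervalIntegral.integral_mul_const, integral_leafProb_step]
          congr 1
          ring
      _ = ∫⁻ r in Set.Ioc 0 t, ENNReal.ofReal ((Real.exp (-(lam * (t - r))) ^ 2 *
              (1 - Real.exp (-(lam * (t - r)))) ^ m) * c) ∂(expMeasure lam) := by
          rw [setLIntegral_expMeasure hlam.out ht (by fun_prop)]
          intro r hr
          have := one_sub_exp_nonneg hlam.out (sub_nonneg.2 hr.2)
          positivity
      _ ≤ ∫⁻ r in Set.Ioc 0 t, ((treeLaw lam).prod (treeLaw lam)) (Prod.mk r ⁻¹'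
            ((fun p : ℝ × (List Bool → ℝ) × (List Bool → ℝ) ↦ node p.1 p.2.1 p.2.2) ⁻¹'
              treeEvent t (m + 1) (m + 2 + k))) ∂(expMeasure lam) :=
          setLIntegral_mono' measurableSet_Ioc hsub
      _ ≤ ∫⁻ r, ((treeLaw lam).prod (treeLaw lam)) (Prod.mk r ⁻¹'
            ((fun p : ℝ × (List Bool → ℝ) × (List Bool → ℝ) ↦ node p.1 p.2.1 p.2.2) ⁻¹'
              treeEvent t (m + 1) (m + 2 + k))) ∂(expMeasure lam) :=
          setLIntegral_le_lintegral _ _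
      _ = treeLaw lam (treeEvent t (m + 1) (m + 2 + k)) := by
          rw [← Measure.prod_apply hmeas,
            ← Measure.map_apply measurable_node (measurableSet_treeEvent _ _ _),
            map_node_treeLaw hlam.out]

lemma tsum_leafProb_mul_coeff {lam t : ℝ} (hlam : 0 < lam) (ht : 0 ≤ t) :
    ∑' a : ℕ × ℕ, ENNReal.ofReal (leafProb lam t a.1 * (depthPoly a.1).coeff a.2) = 1 := by
  rw [ENNReal.tsum_prod' (f := fun a : ℕ × ℕ ↦
    ENNReal.ofReal (leafProb lam t a.1 * (depthPoly a.1).coeff a.2))]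
  have h : ∀ m, ∑' k, ENNReal.ofReal (leafProb lam t m * (depthPoly m).coeff k) =
      ENNReal.ofReal (leafProb lam t m) := by
    intro m
    rw [tsum_eq_sum (s := (depthPoly m).support) (by simp +contextual),
      ← ENNReal.ofReal_sum_of_nonneg fun k _ ↦
        mul_nonneg (leafProb_nonneg hlam ht m) (depthPoly_coeff_nonneg m k), ← Finset.mul_sum]
    have := depthPoly_sum_coeff m
    rw [Polynomial.sum] at this
    rw [this, mul_one]
  simp_rw [h]
  rw [← ENNReal.ofReal_tsum_of_nonneg (leafProb_nonneg hlam ht) (hasSum_leafProb hlam ht).summable,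
    (hasSum_leafProb hlam ht).tsum_eq, ENNReal.ofReal_one]

lemma pairwise_disjoint_treeEvent (t : ℝ) :
    Pairwise (Function.onFun Disjoint fun a : ℕ × ℕ ↦ treeEvent t a.1 a.2) := by
  rintro ⟨m, k⟩ ⟨m', k'⟩ hne
  refine Set.disjoint_left.2 ?_
  rintro x ⟨h1, h2⟩ ⟨h3, h4⟩
  simp only [Prod.mk.injEq, ne_eq] at hne h1 h2 h3 h4
  omega

/-- The lower bounds of `le_treeLaw_treeEvent` for the probabilities of the disjoint events
`treeEvent t m k` add up to `1`, hence are equalities. -/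
lemma treeLaw_treeEvent {lam : ℝ} [hlam : Fact (0 < lam)] {t : ℝ} (ht : 0 ≤ t) (m k : ℕ) :
    treeLaw lam (treeEvent t m k) =
      ENNReal.ofReal (leafProb lam t m * (depthPoly m).coeff k) := by
  have h1 : ∑' a : ℕ × ℕ, treeLaw lam (treeEvent t a.1 a.2) ≤ 1 := by
    rw [← measure_iUnion (pairwise_disjoint_treeEvent t) fun a ↦ measurableSet_treeEvent _ _ _]
    exact prob_le_one
  refine le_antisymm ?_ (le_treeLaw_treeEvent m ht k)
  by_contra! hlt
  have h2 := ENNReal.tsum_lt_tsum (f := fun a : ℕ × ℕ ↦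
      ENNReal.ofReal (leafProb lam t a.1 * (depthPoly a.1).coeff a.2))
    (g := fun a ↦ treeLaw lam (treeEvent t a.1 a.2)) (i := (m, k))
    (by rw [tsum_leafProb_mul_coeff hlam.out ht]; exact ENNReal.one_ne_top)
    (fun a ↦ le_treeLaw_treeEvent a.1 ht a.2) hlt
  rw [tsum_leafProb_mul_coeff hlam.out ht] at h2
  exact h2.not_ge h1

lemma ae_Z_ne_zero_treeLaw {lam : ℝ} [hlam : Fact (0 < lam)] {t : ℝ} (ht : 0 ≤ t) :
    ∀ᵐ x ∂treeLaw lam, Z x t ≠ 0 := by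
  have h : treeLaw lam (⋃ a : ℕ × ℕ, treeEvent t a.1 a.2) = 1 := by
    rw [measure_iUnion (pairwise_disjoint_treeEvent t) fun a ↦ measurableSet_treeEvent _ _ _]
    simp_rw [treeLaw_treeEvent ht]
    exact tsum_leafProb_mul_coeff hlam.out ht
  have h' : ∀ᵐ x ∂treeLaw lam, x ∈ ⋃ a : ℕ × ℕ, treeEvent t a.1 a.2 :=
    (mem_ae_iff_prob_eq_one (MeasurableSet.iUnion fun a ↦ measurableSet_treeEvent _ _ _)).2 h
  refine h'.mono fun x hx ↦ ?_
  obtain ⟨a, ha⟩ := Set.mem_iUnion.1 hx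
  have := ha.1
  omega

/-! ### The conditional variance of the average depth -/

lemma iUnion_eq_univ_ae {Ω : Type*} [MeasurableSpace Ω] {μ : Measure Ω} {N : Ω → ℕ}
    (h0 : ∀ᵐ ω ∂μ, N ω ≠ 0) :
    (⋃ m : ℕ, {ω | N ω = m + 1}) =ᵐ[μ] Set.univ := by
  refine eventuallyEq_set.2 (h0.mono fun ω hω ↦ ?_)
  simp only [Set.mem_iUnion, Set.mem_ofPred_eq, Set.mem_univ, iff_true]
  exact Nat.exists_eq_succ_of_ne_zero hω

section Mixture

/-! Here `N` and `S` are random variables such that `N = m + 1` has probability `p m`, and given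
this event `S` has generating function `depthPoly m`. -/

variable {Ω : Type*} [MeasurableSpace Ω] {μ : Measure Ω} [IsProbabilityMeasure μ]
  {N S : Ω → ℕ} {p : ℕ → ℝ}

lemma integrableOn_and_setIntegral_comp (hN : Measurable N) (hS : Measurable S)
    (hp : ∀ m, 0 ≤ p m)
    (hlaw : ∀ m k, μ {ω | N ω = m + 1 ∧ S ω = k} =
      ENNReal.ofReal (p m * (depthPoly m).coeff k)) (m : ℕ) (φ : ℕ → ℝ) :
    IntegrableOn (fun ω ↦ φ (S ω)) {ω | N ω = m + 1} μ ∧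
      ∫ ω in {ω | N ω = m + 1}, φ (S ω) ∂μ =
        p m * (depthPoly m).sum fun k c ↦ c * φ k := by
  have hmeas : ∀ k, MeasurableSet {ω | N ω = m + 1 ∧ S ω = k} := fun k ↦
    (hN (measurableSet_singleton (m + 1))).inter (hS (measurableSet_singleton k))
  have hae : {ω | N ω = m + 1} =ᵐ[μ]
      ⋃ k ∈ (depthPoly m).support, {ω | N ω = m + 1 ∧ S ω = k} := by
    have h : ∀ᵐ ω ∂μ, ∀ k ∉ (depthPoly m).support, ¬ (N ω = m + 1 ∧ S ω = k) := by
      rw [ae_all_iff]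
      intro k
      by_cases hk : k ∈ (depthPoly m).support
      · simp [hk]
      · have h0 : μ {ω | N ω = m + 1 ∧ S ω = k} = 0 := by
          rw [hlaw, Polynomial.notMem_support_iff.1 hk, mul_zero, ENNReal.ofReal_zero]
        have h1 : ∀ᵐ ω ∂μ, ¬ (N ω = m + 1 ∧ S ω = k) := by
          rw [ae_iff]; simpa only [not_not] using h0
        exact h1.mono fun ω hω _ ↦ hω
    refine eventuallyEq_set.2 (h.mono fun ω hω ↦ ?_)
    simp only [Set.mem_iUnion, exists_prop, Set.mem_ofPred_eq]
    constructor
    · intro h1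
      by_contra! h2
      exact hω (S ω) (fun h3 ↦ h2 (S ω) h3 h1 rfl) ⟨h1, rfl⟩
    · rintro ⟨k, _, h1, _⟩
      exact h1
  have hconst : ∀ k, IntegrableOn (fun ω ↦ φ (S ω)) {ω | N ω = m + 1 ∧ S ω = k} μ := fun k ↦
    (integrableOn_const (C := φ k)).congr_fun (fun ω hω ↦ by simp [hω.2]) (hmeas k)
  constructor
  · exact IntegrableOn.congr_set_ae
      ((integrableOn_finset_iUnion).2 fun k _ ↦ hconst k) hae
  · rw [setIntegral_congr_set hae, integral_biUnion_finset _ (fun k _ ↦ hmeas k) ?_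
      fun k _ ↦ hconst k, Polynomial.sum, Finset.mul_sum]
    · refine Finset.sum_congr rfl fun k _ ↦ ?_
      rw [setIntegral_congr_fun (g := fun _ ↦ φ k) (hmeas k) fun ω hω ↦ by simp [hω.2],
        setIntegral_const, measureReal_def, hlaw,
        ENNReal.toReal_ofReal (mul_nonneg (hp m) (depthPoly_coeff_nonneg m k)), smul_eq_mul,
        mul_assoc]
    · intro k _ l _ hkl
      refine Set.disjoint_left.2 fun ω h1 h2 ↦ hkl ?_
      rw [← h1.2, ← h2.2]

/-- The mean of `(k / a - b) ^ 2` when `k` has generating function `depthPoly m`. -/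
lemma depthPoly_sum_quadratic (m : ℕ) (a b : ℝ) :
    ((depthPoly m).sum fun k c ↦ c * ((k : ℝ) / a - b) ^ 2) =
      (pathVar (m + 1) + pathMean (m + 1) ^ 2) / a ^ 2 - 2 * b * (pathMean (m + 1) / a)
        + b ^ 2 := by
  have h : ∀ k c : ℝ, c * (k / a - b) ^ 2 =
      (1 / a ^ 2) * (c * k ^ 2) - (2 * b / a) * (c * k) + b ^ 2 * c := by
    intro k c; ring
  have h0 := depthPoly_sum_coeff m
  have h1 := depthPoly_sum_mul m
  have h2 := depthPoly_sum_mul_sq m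
  rw [Polynomial.sum] at h0 h1 h2 ⊢
  simp_rw [h, Finset.sum_add_distrib, Finset.sum_sub_distrib, ← Finset.mul_sum, h0, h1, h2]
  ring

lemma setIntegral_sub_const_sq (hN : Measurable N) (hS : Measurable S)
    (hp : ∀ m, 0 ≤ p m)
    (hlaw : ∀ m k, μ {ω | N ω = m + 1 ∧ S ω = k} =
      ENNReal.ofReal (p m * (depthPoly m).coeff k)) (m : ℕ) (b : ℝ) :
    IntegrableOn (fun ω ↦ ((S ω : ℝ) / N ω - b) ^ 2) {ω | N ω = m + 1} μ ∧
      ∫ ω in {ω | N ω = m + 1}, ((S ω : ℝ) / N ω - b) ^ 2 ∂μ =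
        p m * ((pathVar (m + 1) + pathMean (m + 1) ^ 2) / ((m : ℝ) + 1) ^ 2
          - 2 * b * (pathMean (m + 1) / ((m : ℝ) + 1)) + b ^ 2) := by
  have hs : MeasurableSet {ω | N ω = m + 1} := hN (measurableSet_singleton (m + 1))
  have he : Set.EqOn (fun ω ↦ ((S ω : ℝ) / N ω - b) ^ 2)
      (fun ω ↦ ((S ω : ℝ) / ((m : ℝ) + 1) - b) ^ 2) {ω | N ω = m + 1} := by
    intro ω hω
    have : N ω = m + 1 := hω
    simp [this]
  have h := integrableOn_and_setIntegral_comp hN hS hp hlaw m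
    (fun k ↦ ((k : ℝ) / ((m : ℝ) + 1) - b) ^ 2)
  rw [depthPoly_sum_quadratic] at h
  exact ⟨h.1.congr_fun he.symm hs, (setIntegral_congr_fun hs he).trans h.2⟩

lemma exists_pathVar_le : ∃ C, ∀ n : ℕ, |pathVar (n + 1) / ((n : ℝ) + 1) ^ 2| ≤ C := by
  obtain ⟨C, hC⟩ := (tendsto_pathVar_div_sq.abs).bddAbove_range
  exact ⟨C, fun n ↦ hC ⟨n, rfl⟩⟩

/-- The second moment of `S / N` given `N = m + 1` grows at most like `(m + 1) ^ 2`. -/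
lemma memLp_ratio (hN : Measurable N) (hS : Measurable S) (hp : ∀ m, 0 ≤ p m)
    (hlaw : ∀ m k, μ {ω | N ω = m + 1 ∧ S ω = k} =
      ENNReal.ofReal (p m * (depthPoly m).coeff k))
    (h0 : ∀ᵐ ω ∂μ, N ω ≠ 0)
    (hsum : Summable fun m : ℕ ↦ p m * ((m : ℝ) + 1) ^ 2) :
    MemLp (fun ω ↦ (S ω : ℝ) / N ω) 2 μ := by
  have hmeas : Measurable fun ω ↦ (S ω : ℝ) / N ω :=
    (measurable_from_top.comp hS).div (measurable_from_top.comp hN)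
  rw [memLp_two_iff_integrable_sq hmeas.aestronglyMeasurable, ← integrableOn_univ]
  refine IntegrableOn.congr_set_ae ?_ (iUnion_eq_univ_ae h0).symm
  have h := fun m ↦ setIntegral_sub_const_sq hN hS hp hlaw m 0
  simp only [sub_zero, mul_zero, zero_mul, ne_eq, OfNat.ofNat_ne_zero, not_false_eq_true,
    zero_pow, add_zero] at h
  refine integrableOn_iUnion_of_summable_integral_norm (fun m ↦ (h m).1) ?_
  obtain ⟨C, hC⟩ := exists_pathVar_le
  refine Summable.of_nonneg_of_le (fun m ↦ integral_nonneg fun ω ↦ norm_nonneg _) (fun m ↦ ?_)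
    (hsum.mul_left (C + 4))
  simp only [norm_pow, Real.norm_eq_abs, sq_abs]
  rw [(h m).2, mul_left_comm]
  refine mul_le_mul_of_nonneg_left ?_ (hp m)
  have h1 : (1 : ℝ) ≤ ((m : ℝ) + 1) ^ 2 :=
    one_le_pow₀ (by linarith [(Nat.cast_nonneg m : (0 : ℝ) ≤ m)])
  have h2 := (le_abs_self _).trans (hC m)
  have hC0 := (abs_nonneg _).trans (hC m)
  have h3 : pathMean (m + 1) ^ 2 / ((m : ℝ) + 1) ^ 2 ≤ 4 * ((m : ℝ) + 1) ^ 2 := by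
    rw [div_le_iff₀ (by positivity)]
    have h4 := pathMean_le (m + 1)
    push_cast at h4
    calc pathMean (m + 1) ^ 2 ≤ (2 * ((m : ℝ) + 1) * (m + 1)) ^ 2 :=
          pow_le_pow_left₀ (pathMean_nonneg _) h4 2
      _ = _ := by ring
  rw [add_div, add_mul]
  exact add_le_add (h2.trans (le_mul_of_one_le_right hC0 h1)) h3

/-- The expected conditional variance of `S / N` given `N` is the average, over the values `m + 1`
of `N`, of the variance of the external path length of a random binary search tree with `m + 1`
leaves, divided by `(m + 1) ^ 2`. -/
lemma integral_condVar_ratio (hN : Measurable N) (hS : Measurable S) (hp : ∀ m, 0 ≤ p m)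
    (hlaw : ∀ m k, μ {ω | N ω = m + 1 ∧ S ω = k} =
      ENNReal.ofReal (p m * (depthPoly m).coeff k))
    (h0 : ∀ᵐ ω ∂μ, N ω ≠ 0) (hX : MemLp (fun ω ↦ (S ω : ℝ) / N ω) 2 μ) :
    ∫ ω, (condVar (MeasurableSpace.comap N ⊤) (fun ω ↦ (S ω : ℝ) / N ω) μ) ω ∂μ =
      ∑' m, p m * (pathVar (m + 1) / ((m : ℝ) + 1) ^ 2) := by
  set X : Ω → ℝ := fun ω ↦ (S ω : ℝ) / N ω with hXdef
  have hle : MeasurableSpace.comap N ⊤ ≤ ‹MeasurableSpace Ω› := hN.comap_le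
  have hs : ∀ m, MeasurableSet {ω | N ω = m + 1} := fun m ↦
    hN (measurableSet_singleton (m + 1))
  have hs' : ∀ m, MeasurableSet[MeasurableSpace.comap N ⊤] {ω | N ω = m + 1} := fun m ↦
    ⟨{m + 1}, trivial, rfl⟩
  -- the conditional expectation is constant on the events `N = m + 1`
  obtain ⟨g, -, hg⟩ : ∃ g : ℕ → ℝ, Measurable g ∧ μ[X | MeasurableSpace.comap N ⊤] = g ∘ N :=
    Measurable.exists_eq_measurable_comp stronglyMeasurable_condExp.measurable
  have hsq : Integrable ((X - μ[X | MeasurableSpace.comap N ⊤]) ^ 2) μ :=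
    (hX.sub (hX.condExp one_le_two)).integrable_sq
  have hd : Pairwise (Function.onFun Disjoint fun m : ℕ ↦ {ω | N ω = m + 1}) := by
    intro m n hmn
    refine Set.disjoint_left.2 fun ω h1 h2 ↦ hmn ?_
    simp only [Set.mem_ofPred_eq] at h1 h2
    omega
  rw [← setIntegral_univ, ← setIntegral_congr_set (iUnion_eq_univ_ae h0),
    integral_iUnion hs hd integrable_condVar.integrableOn]
  refine tsum_congr fun m ↦ ?_
  rw [setIntegral_condVar (hm := hle) hsq (hs' m), hg]
  have h1 : ∫ ω in {ω | N ω = m + 1}, (X ω - (g ∘ N) ω) ^ 2 ∂μ =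
      ∫ ω in {ω | N ω = m + 1}, (X ω - g (m + 1)) ^ 2 ∂μ :=
    setIntegral_congr_fun (hs m) fun ω hω ↦ by
      have : N ω = m + 1 := hω
      simp [this]
  rw [h1, (setIntegral_sub_const_sq hN hS hp hlaw m _).2]
  -- the value of this constant, when `N = m + 1` has positive probability
  have h2 : p m * (pathMean (m + 1) / ((m : ℝ) + 1)) = p m * g (m + 1) := by
    have hint := hX.integrable (by norm_num)
    have h3 := setIntegral_condExp hle hint (hs' m)
    rw [hg, setIntegral_congr_fun (g := fun _ ↦ g (m + 1)) (hs m)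
        fun ω hω ↦ by have : N ω = m + 1 := hω; simp [this],
      (integrableOn_and_setIntegral_comp hN hS hp hlaw m fun _ ↦ g (m + 1)).2,
      setIntegral_congr_fun (g := fun ω ↦ (S ω : ℝ) / ((m : ℝ) + 1)) (hs m)
        fun ω hω ↦ by have : N ω = m + 1 := hω; simp [hXdef, this],
      (integrableOn_and_setIntegral_comp hN hS hp hlaw m fun k ↦ (k : ℝ) / ((m : ℝ) + 1)).2]
      at h3
    have e0 := depthPoly_sum_coeff m
    have e1 := depthPoly_sum_mul m
    rw [Polynomial.sum] at e0 e1
    simp_rw [Polynomial.sum, ← mul_div_assoc, ← Finset.sum_mul, ← Finset.sum_div, e0, e1,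
      one_mul] at h3
    exact h3.symm
  rcases (hp m).eq_or_lt with hpm | hpm
  · simp [← hpm]
  · rw [← mul_left_cancel₀ hpm.ne' h2]
    field_simp
    ring

end Mixture

/-! ### The limit -/

/-- Abel's theorem in the form of a limit of geometric averages. -/
lemma tendsto_tsum_one_sub_mul_pow {v : ℕ → ℝ} {L : ℝ} (hv : Tendsto v atTop (𝓝 L)) :
    Tendsto (fun x : ℝ ↦ ∑' n, (1 - x) * x ^ n * v n) (𝓝[<] 1) (𝓝 L) := by
  let f : ℕ → ℝ := fun n ↦ n.casesOn (v 0) fun n ↦ v (n + 1) - v n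
  have hf : ∀ n, ∑ i ∈ Finset.range (n + 1), f i = v n := by
    intro n
    rw [Finset.sum_range_succ', Finset.sum_range_sub v n]
    exact sub_add_cancel _ _
  have h := Real.tendsto_tsum_powerSeries_nhdsWithin_lt (f := f) (l := L)
    ((tendsto_add_atTop_iff_nat 1).1 (by simpa only [hf] using hv))
  refine h.congr' ?_
  have hpos : ∀ᶠ x : ℝ in 𝓝[<] 1, x ∈ Set.Ioo (0 : ℝ) 1 := Ioo_mem_nhdsLT one_pos
  filter_upwards [hpos] with x hx
  obtain ⟨C, hC⟩ := hv.abs.bddAbove_range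
  have hsum : Summable fun n ↦ v n * x ^ n := by
    refine Summable.of_norm_bounded
      ((summable_geometric_of_lt_one hx.1.le hx.2).mul_left C) fun n ↦ ?_
    rw [norm_mul, norm_pow, Real.norm_eq_abs, Real.norm_of_nonneg hx.1.le]
    exact mul_le_mul_of_nonneg_right (hC ⟨n, rfl⟩) (pow_nonneg hx.1.le n)
  have hsum1 : Summable fun n ↦ v (n + 1) * x ^ (n + 1) :=
    (summable_nat_add_iff (f := fun n ↦ v n * x ^ n) 1).2 hsum
  have hfsucc : ∀ n, f (n + 1) * x ^ (n + 1) = v (n + 1) * x ^ (n + 1) - x * (v n * x ^ n) := by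
    intro n
    change (v (n + 1) - v n) * x ^ (n + 1) = _
    ring
  have hfsum : Summable fun n ↦ f n * x ^ n := by
    rw [← summable_nat_add_iff 1]
    simp_rw [hfsucc]
    exact hsum1.sub (hsum.mul_left x)
  rw [hfsum.tsum_eq_zero_add]
  simp_rw [hfsucc]
  rw [hsum1.tsum_sub (hsum.mul_left x), tsum_mul_left]
  have h1 := hsum.tsum_eq_zero_add
  have h2 : ∑' n, (1 - x) * x ^ n * v n = (1 - x) * ∑' n, v n * x ^ n := by
    rw [← tsum_mul_left]
    exact tsum_congr fun n ↦ by ring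
  rw [h2]
  have h3 : f 0 = v 0 := rfl
  rw [h3]
  linear_combination -h1

lemma tendsto_tsum_leafProb_mul {lam : ℝ} (hlam : 0 < lam) {v : ℕ → ℝ} {L : ℝ}
    (hv : Tendsto v atTop (𝓝 L)) :
    Tendsto (fun t : ℝ ↦ ∑' m, leafProb lam t m * v m) atTop (𝓝 L) := by
  have h1 : Tendsto (fun t : ℝ ↦ 1 - Real.exp (-(lam * t))) atTop (𝓝[<] 1) := by
    refine tendsto_nhdsWithin_iff.2 ⟨?_, Eventually.of_forall fun t ↦ one_sub_exp_lt_one lam t⟩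
    have h2 : Tendsto (fun t : ℝ ↦ Real.exp (-(lam * t))) atTop (𝓝 0) :=
      Real.tendsto_exp_neg_atTop_nhds_zero.comp (tendsto_id.const_mul_atTop hlam)
    simpa using h2.const_sub 1
  refine ((tendsto_tsum_one_sub_mul_pow hv).comp h1).congr fun t ↦ ?_
  simp [leafProb]

lemma summable_leafProb_mul_sq {lam t : ℝ} (hlam : 0 < lam) (ht : 0 ≤ t) :
    Summable fun m : ℕ ↦ leafProb lam t m * ((m : ℝ) + 1) ^ 2 := by
  have hx : ‖1 - Real.exp (-(lam * t))‖ < 1 := by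
    rw [Real.norm_of_nonneg (one_sub_exp_nonneg hlam ht)]
    exact one_sub_exp_lt_one lam t
  have h := fun k ↦ summable_pow_mul_geometric_of_norm_lt_one k hx
  refine ((((h 2).add ((h 1).mul_left 2)).add (h 0)).mul_left (Real.exp (-(lam * t)))).congr
    fun m ↦ ?_
  rw [leafProb]
  ring

end PureBirth

theorem lemma2 {Ω : Type*} [MeasurableSpace Ω] (μ : Measure Ω) [IsProbabilityMeasure μ]
    (lam : ℝ) (hlam : 0 < lam) (τ : List Bool → Ω → ℝ)
    (hmeas : ∀ u, Measurable (τ u))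
    (hindep : iIndepFun τ μ)
    (hlaw : ∀ u, μ.map (τ u) = expMeasure lam) :
    (∀ t : ℝ, 0 ≤ t →
      (∀ᵐ ω ∂μ, (PureBirth.leaves (fun u ↦ τ u ω) t).Finite ∧
        (PureBirth.leaves (fun u ↦ τ u ω) t).Nonempty) ∧
      Measurable (fun ω ↦ PureBirth.Z (fun u ↦ τ u ω) t) ∧
      MemLp (fun ω ↦ PureBirth.avgDepth (fun u ↦ τ u ω) t) 2 μ) ∧
    Tendsto
      (fun t : ℝ ↦ ∫ ω, (condVar
        (MeasurableSpace.comap (fun ω' ↦ PureBirth.Z (fun u ↦ τ u ω') t) ⊤)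
        (fun ω' ↦ PureBirth.avgDepth (fun u ↦ τ u ω') t) μ) ω ∂μ)
      atTop (𝓝 (7 - 2 / 3 * Real.pi ^ 2)) := by
  have : Fact (0 < lam) := ⟨hlam⟩
  have hT : Measurable fun (ω : Ω) (u : List Bool) ↦ τ u ω := measurable_pi_iff.2 hmeas
  have hmap : μ.map (fun ω u ↦ τ u ω) = PureBirth.treeLaw lam := by
    rw [hindep.map_fun_eq_infinitePi_map hmeas]
    simp_rw [hlaw]
    rfl
  have hZG : ∀ t, Measurable fun ω ↦
      (PureBirth.Z (fun u ↦ τ u ω) t, PureBirth.G (fun u ↦ τ u ω) t) := fun t ↦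
    PureBirth.measurable_Z_G.comp (f := fun ω : Ω ↦ ((fun u ↦ τ u ω), t))
      (hT.prodMk measurable_const)
  have h0 : ∀ t, 0 ≤ t → ∀ᵐ ω ∂μ, PureBirth.Z (fun u ↦ τ u ω) t ≠ 0 := fun t ht ↦
    ae_of_ae_map hT.aemeasurable (hmap ▸ PureBirth.ae_Z_ne_zero_treeLaw ht)
  have hjoint : ∀ t, 0 ≤ t → ∀ m k, μ {ω | PureBirth.Z (fun u ↦ τ u ω) t = m + 1 ∧
      PureBirth.G (fun u ↦ τ u ω) t = k} =
      ENNReal.ofReal (PureBirth.leafProb lam t m * (PureBirth.depthPoly m).coeff k) := by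
    intro t ht m k
    rw [← PureBirth.treeLaw_treeEvent ht, ← hmap,
      Measure.map_apply hT (PureBirth.measurableSet_treeEvent t m k)]
    rfl
  have hLp : ∀ t, 0 ≤ t → MemLp (fun ω ↦ PureBirth.avgDepth (fun u ↦ τ u ω) t) 2 μ :=
    fun t ht ↦ PureBirth.memLp_ratio (hZG t).fst (hZG t).snd
      (PureBirth.leafProb_nonneg hlam ht) (hjoint t ht) (h0 t ht)
      (PureBirth.summable_leafProb_mul_sq hlam ht)
  refine ⟨fun t ht ↦ ⟨(h0 t ht).mono fun ω hω ↦ ⟨Set.finite_of_ncard_ne_zero hω,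
    Set.nonempty_of_ncard_ne_zero hω⟩, (hZG t).fst, hLp t ht⟩, ?_⟩
  refine (PureBirth.tendsto_tsum_leafProb_mul hlam PureBirth.tendsto_pathVar_div_sq).congr' ?_
  filter_upwards [eventually_ge_atTop 0] with t ht
  exact (PureBirth.integral_condVar_ratio (hZG t).fst (hZG t).snd
    (PureBirth.leafProb_nonneg hlam ht) (hjoint t ht) (h0 t ht) (hLp t ht)).symm
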